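/- All graphs are finite. An oriented graph is a directed graph without loops and without pairs of opposite arcs. Pushing a vertex $v$ of an oriented graph reverses all arcs incident with $v$. A homomorphism from an oriented graph $\overrightarrow{G}$ to an oriented graph $\overrightarrow{H}$ is a map $V(\overrightarrow{G}) \to V(\overrightarrow{H})$ that sends arcs to arcs, and $\chi_p(\overrightarrow{G})$ is the minimum number of vertices of an oriented graph $\overrightarrow{H}$ such that some oriented graph obtained from $\overrightarrow{G}$ by pushing some (possibly no) vertices admits a homomorphism to $\overrightarrow{H}$. For a simple undirected graph $G$, let $\chi_p(G)$ be the maximum of $\chi_p(\overrightarrow{G})$ over all orientations $\overrightarrow{G}$ of $G$; let $\mathcal{G}^{\mathrm c}_{\Delta}$ be the family of connected simple graphs with maximum degree $\Delta$, and $\chi_p(\mathcal{G}^{\mathrm c}_{\Delta}) = \max\{\chi_p(G) : G \in \mathcal{G}^{\mathrm c}_{\Delta}\}$. Theorem. For every integer $\Delta \ge 29$, the maximum defining $\chi_p(\mathcal{G}^{\mathrm c}_{\Delta})$ exists, and $$2^{\frac{\Delta}{2}-1} \;\le\; \chi_p(\mathcal{G}^{\mathrm c}_{\Delta}) \;\le\;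 (\Delta-3)\,(\Delta-1)\,2^{\Delta-1} + 2 .$$ -/

import Mathlib

universe u v

/-- An oriented graph on the vertex set `V`: a digraph without opposite arcs
(taking `x = y` in the field, it has no loops either). `D.Adj x y` means that `xy` is an arc. -/
@[ext]
structure OrientedGraph (V : Type u) extends Digraph V where
  asymm : ∀ x y : V, Adj x y → ¬ Adj y x

namespace OrientedGraph

variable {V : Type u} {W : Type v}

/-- The underlying simple undirected graph of an oriented graph. -/
def underlying (D : OrientedGraph V) : SimpleGraph V where
  Adj x y := D.Adj x y ∨ D.Adj y x
  symm := ⟨fun _ _ h => h.symm⟩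
  loopless := ⟨fun x h => h.elim (fun h => D.asymm x x h h) (fun h => D.asymm x x h h)⟩

/-- `D` is an orientation of the simple graph `G`. -/
def IsOrientation (D : OrientedGraph V) (G : SimpleGraph V) : Prop :=
  D.underlying = G

/-- Pushing the vertex `z`: every arc incident with `z` is reversed, every other arc is kept. -/
def push (D : OrientedGraph V) (z : V) : OrientedGraph V where
  Adj x y := ((x = z ∨ y = z) ∧ D.Adj y x) ∨ (¬ (x = z ∨ y = z) ∧ D.Adj x y)
  asymm x y := by
    have h₁ := D.asymm x y
    have h₂ := D.asymm y x
    tauto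

/-- `D'` is in a push relationship with `D`: it is obtained from `D` by pushing some vertices
(finitely many, one after the other, possibly none). -/
def PushRelated (D D' : OrientedGraph V) : Prop :=
  Relation.ReflTransGen (fun D₁ D₂ : OrientedGraph V => ∃ z : V, D₂ = D₁.push z) D D'

/-- `φ` is a homomorphism from `D` to `H`: arcs are mapped to arcs. -/
def IsHom (D : OrientedGraph V) (H : OrientedGraph W) (φ : V → W) : Prop :=
  ∀ x y : V, D.Adj x y → H.Adj (φ x) (φ y)

/-- `φ` is a pushable homomorphism from `D` to `H`: it is a homomorphism to `H` from some
oriented graph in a push relationship with `D`. -/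
def IsPushableHom (D : OrientedGraph V) (H : OrientedGraph W) (φ : V → W) : Prop :=
  ∃ D' : OrientedGraph V, D.PushRelated D' ∧ D'.IsHom H φ

/-- The orders of the oriented graphs to which `D` admits a pushable homomorphism. -/
def pushableOrders (D : OrientedGraph V) : Set ℕ :=
  {n | ∃ (H : OrientedGraph (Fin n)) (φ : V → Fin n), D.IsPushableHom H φ}

/-- The pushable chromatic number of an oriented graph `D`: the minimum order of an oriented graph
to which `D` admits a pushable homomorphism. -/
noncomputable def pushableChromaticNumber (D : OrientedGraph V) : ℕ :=
  sInf D.pushableOrders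

theorem card_mem_pushableOrders [Finite V] (D : OrientedGraph V) :
    Nat.card V ∈ D.pushableOrders := by
  let e := Finite.equivFin V
  refine ⟨⟨⟨fun i j => D.Adj (e.symm i) (e.symm j)⟩, fun i j => D.asymm _ _⟩, e, D,
    Relation.ReflTransGen.refl, fun x y h => ?_⟩
  simpa using h

/-- For a finite oriented graph the minimum is attained. -/
theorem isLeast_pushableChromaticNumber [Finite V] (D : OrientedGraph V) :
    IsLeast D.pushableOrders D.pushableChromaticNumber :=
  ⟨Nat.sInf_mem ⟨_, D.card_mem_pushableOrders⟩, fun _ h => Nat.sInf_le h⟩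

end OrientedGraph

/-- The pushable chromatic numbers of the orientations of the simple graph `G`. -/
def SimpleGraph.pushableValues {V : Type u} (G : SimpleGraph V) : Set ℕ :=
  {k | ∃ D : OrientedGraph V, D.IsOrientation G ∧ D.pushableChromaticNumber = k}

/-- The pushable chromatic number of a simple graph `G`: the maximum of the pushable chromatic
numbers of its orientations. -/
noncomputable def SimpleGraph.pushableChromaticNumber {V : Type u} (G : SimpleGraph V) : ℕ :=
  sSup G.pushableValues

/-- For a finite graph the maximum over its orientations is attained. -/
theorem SimpleGraph.isGreatest_pushableChromaticNumber {V : Type u} [Finite V]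
    (G : SimpleGraph V) : IsGreatest G.pushableValues G.pushableChromaticNumber := by
  have hne : G.pushableValues.Nonempty := by
    obtain ⟨r, hr⟩ : ∃ r : LinearOrder V, True := by
      classical
      exact ⟨linearOrderOfSTO WellOrderingRel, trivial⟩
    refine ⟨_, ⟨⟨fun x y => G.Adj x y ∧ x < y⟩, fun x y h h' => lt_asymm h.2 h'.2⟩, ?_, rfl⟩
    ext x y
    constructor
    · rintro (h | h)
      exacts [h.1, h.1.symm]
    · intro h
      rcases lt_or_gt_of_ne h.ne with h' | h'
      exacts [Or.inl ⟨h, h'⟩, Or.inr ⟨h.symm, h'⟩]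
  have hbdd : BddAbove G.pushableValues := by
    refine ⟨Nat.card V, ?_⟩
    rintro _ ⟨D, -, rfl⟩
    exact D.isLeast_pushableChromaticNumber.2 D.card_mem_pushableOrders
  exact ⟨Nat.sSup_mem hne hbdd, fun _ h => le_csSup hbdd h⟩

/-- A finite simple graph together with its vertex set. -/
structure FiniteGraph : Type (u + 1) where
  V : Type u
  [fintypeV : Fintype V]
  graph : SimpleGraph V

attribute [instance] FiniteGraph.fintypeV

open Classical in
/-- The family of connected finite graphs with maximum degree (exactly) `Δ`. -/
def connectedGraphsOfMaxDegree (Δ : ℕ) : Set FiniteGraph.{u} :=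
  {G | G.graph.Connected ∧ G.graph.maxDegree = Δ}

/-- The pushable chromatic numbers of the members of a family of graphs. -/
def familyPushableValues (F : Set FiniteGraph.{u}) : Set ℕ :=
  {k | ∃ G ∈ F, G.graph.pushableChromaticNumber = k}

/-- The pushable chromatic number of a family of graphs: the maximum of the pushable chromatic
numbers of its members. The maximum exists when `familyPushableValues F` is non-empty and bounded
(this is asserted separately where it is used); otherwise the value is a default. -/
noncomputable def familyPushableChromaticNumber (F : Set FiniteGraph.{u}) : ℕ :=
  sSup (familyPushableValues F)

/-! Upper bound. Put `k = Δ - 1` and `n = (k - 2) k 2^k`. Some tournament on `n` vertices is rich: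
on every `k`-set, every pattern of arcs is realised, up to a push, by at least `k + 1` outside
vertices (`exists_tournament`, probabilistic). The graph is mapped to this tournament greedily, in
order of decreasing distance from a root. Each vertex other than the root then still has an
uncoloured neighbour, hence at most `k` coloured ones. The coloured neighbours of any uncoloured
vertex are kept distinctly coloured, so that the pattern demanded at the next vertex is consistent;
preserving this forbids fewer colours than richness supplies (`IsPartialColouring.exists_insert`).
The root may have `k + 1` coloured neighbours and receives a new target vertex, so `n + 1` vertices
suffice, one fewer than claimed.

Lower bound. A connected `Δ`-regular bipartite graph on `2N` vertices has `2^(Δ N)` orientations.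
Each is determined by a target of order `K`, a vertex map and a set of pushed vertices, so `2^(Δ N)
≤ 2^(K^2) (2K)^(2N)`. Letting `N` grow with `K` fixed gives `2^Δ ≤ 4 K^2`. -/

/-! ### Rich tournaments by the probabilistic method -/

/-- The tournament on `Fin n` whose arcs are read off the entries of `f` above the diagonal. -/
def tournamentOf {n : ℕ} (f : Fin n → Fin n → Bool) (x y : Fin n) : Bool :=
  if x < y then f x y else !f y x

theorem tournamentOf_swap {n : ℕ} (f : Fin n → Fin n → Bool) {x y : Fin n} (h : x ≠ y) :
    tournamentOf f y x = !tournamentOf f x y := by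
  unfold tournamentOf
  rcases lt_or_gt_of_ne h with h | h
  · simp [h, h.not_gt]
  · simp [h, h.not_gt]

/-- The row `r` agrees on `S` with the indicator of `A`, or with its complement. -/
def Matches {W : Type*} (S A : Finset W) (r : W → Bool) : Prop :=
  ∃ b : Bool, ∀ x ∈ S, (r x = b ↔ x ∈ A)

open Classical in
/-- The vertices outside `S` whose rows agree with `A` on `S` up to a push. -/
noncomputable def matchSet {n : ℕ} (t : Fin n → Fin n → Bool) (S A : Finset (Fin n)) :
    Finset (Fin n) :=
  Finset.univ.filter fun u => u ∉ S ∧ Matches S A (t u)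

theorem mem_matchSet {n : ℕ} {t : Fin n → Fin n → Bool} {S A : Finset (Fin n)} {u : Fin n} :
    u ∈ matchSet t S A ↔ u ∉ S ∧ ∃ b : Bool, ∀ x ∈ S, (t u x = b ↔ x ∈ A) := by
  simp [matchSet, Matches]

theorem card_rows {n : ℕ} (S A : Finset (Fin n)) (b : Bool) :
    (Finset.univ.filter fun r : Fin n → Bool => ∀ x ∈ S, (r x = b ↔ x ∈ A)).card
      = 2 ^ (n - S.card) := by
  classical
  have : (Finset.univ.filter fun r : Fin n → Bool => ∀ x ∈ S, (r x = b ↔ x ∈ A))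
      = Fintype.piFinset fun x => if x ∈ S then {if x ∈ A then b else !b}
          else (Finset.univ : Finset Bool) := by
    ext r
    simp only [Finset.mem_filter, Finset.mem_univ, true_and, Fintype.mem_piFinset]
    refine forall_congr' fun x => ?_
    by_cases hS : x ∈ S
    · by_cases hA : x ∈ A
      · simp [hS, hA]
      · cases b <;> simp [hS, hA]
    · simp [hS]
  rw [this, Fintype.card_piFinset]
  have h2 : ∀ x : Fin n, (if x ∈ S then ({if x ∈ A then b else !b} : Finset Bool)
      else Finset.univ).card = if x ∈ S then 1 else 2 := by
    intro x
    split_ifs <;> simp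
  simp only [h2]
  rw [Finset.prod_ite]
  simp only [Finset.prod_const_one, one_mul, Finset.prod_const]
  congr 1
  rw [Finset.filter_not, Finset.filter_mem_eq_inter, Finset.univ_inter,
    Finset.card_sdiff_of_subset (Finset.subset_univ _), Finset.card_univ, Fintype.card_fin]

open Classical in
-- Since `S` is nonempty, the two values of the push bit exclude each other; hence the factor 2.
theorem card_matches {n : ℕ} {S : Finset (Fin n)} (A : Finset (Fin n)) (hS : S.Nonempty) :
    (Finset.univ.filter fun r : Fin n → Bool => Matches S A r).card = 2 * 2 ^ (n - S.card) := by
  have : (Finset.univ.filter fun r : Fin n → Bool => Matches S A r)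
      = (Finset.univ.filter fun r : Fin n → Bool => ∀ x ∈ S, (r x = true ↔ x ∈ A)) ∪
        (Finset.univ.filter fun r : Fin n → Bool => ∀ x ∈ S, (r x = false ↔ x ∈ A)) := by
    ext r
    simp only [Matches, Finset.mem_filter, Finset.mem_univ, true_and, Finset.mem_union,
      Bool.exists_bool]
    exact or_comm
  rw [this, Finset.card_union_of_disjoint, card_rows, card_rows, two_mul]
  rw [Finset.disjoint_left]
  intro r h1 h2
  simp only [Finset.mem_filter, Finset.mem_univ, true_and] at h1 h2
  obtain ⟨x, hx⟩ := hS
  have h1 := h1 x hx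
  have h2 := h2 x hx
  cases h : r x <;> simp_all

/-- Exchange the entries of `f` between `S` and its complement, so that the rows outside `S`
of the new matrix carry the arcs of the tournament of `f` to `S`. -/
def crossSwap {n : ℕ} (S : Finset (Fin n)) (f : Fin n → Fin n → Bool) (x y : Fin n) : Bool :=
  if x ∉ S ∧ y ∈ S ∧ y < x ∨ x ∈ S ∧ y ∉ S ∧ x < y then !f y x else f x y

theorem crossSwap_involutive {n : ℕ} (S : Finset (Fin n)) :
    Function.Involutive (crossSwap S) := by
  intro f
  funext x y
  unfold crossSwap
  by_cases h : x ∉ S ∧ y ∈ S ∧ y < x ∨ x ∈ S ∧ y ∉ S ∧ x < y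
  · have h' : y ∉ S ∧ x ∈ S ∧ x < y ∨ y ∈ S ∧ x ∉ S ∧ y < x := by tauto
    rw [if_pos h, if_pos h', Bool.not_not]
  · rw [if_neg h, if_neg h]

theorem tournamentOf_crossSwap {n : ℕ} {S : Finset (Fin n)} (f : Fin n → Fin n → Bool)
    {u x : Fin n} (hu : u ∉ S) (hx : x ∈ S) : tournamentOf (crossSwap S f) u x = f u x := by
  have hne : u ≠ x := fun h => hu (h ▸ hx)
  unfold tournamentOf crossSwap
  rcases lt_or_gt_of_ne hne with h | h
  · simp [h, hu, hx, h.not_gt]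
  · simp [h, hu, hx, h.not_gt]

open Classical in
-- After the bijection `crossSwap S`, whether `u` belongs to `matchSet` depends on row `u` alone, so
-- the sum factors over rows. A row in `S` contributes `2 ^ n`; any other row loses `3 / 4` for each
-- matching value.
theorem sum_weight_matchSet {n : ℕ} {S : Finset (Fin n)} (A : Finset (Fin n)) (hS : S.Nonempty) :
    ∑ f : Fin n → Fin n → Bool, (1 / 4 : ℝ) ^ (matchSet (tournamentOf f) S A).card
      = (2 ^ n) ^ S.card * (2 ^ n - 3 / 4 * (2 * 2 ^ (n - S.card))) ^ (n - S.card) := by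
  rw [← Equiv.sum_comp ((crossSwap_involutive S).toPerm _)]
  have h1 : ∀ f : Fin n → Fin n → Bool,
      (1 / 4 : ℝ) ^ (matchSet (tournamentOf ((crossSwap_involutive S).toPerm _ f)) S A).card
        = ∏ u, if u ∉ S ∧ Matches S A (f u) then (1 / 4 : ℝ) else 1 := by
    intro f
    rw [Finset.prod_ite, Finset.prod_const_one, mul_one, Finset.prod_const]
    congr 2
    unfold matchSet
    refine Finset.filter_congr fun u _ => and_congr_right fun hu => ?_
    unfold Matches
    refine exists_congr fun b => forall₂_congr fun x hx => ?_
    rw [Function.Involutive.coe_toPerm, tournamentOf_crossSwap f hu hx]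
  simp only [h1]
  have h2 := Finset.prod_univ_sum (fun _ : Fin n => (Finset.univ : Finset (Fin n → Bool)))
    (fun u r => if u ∉ S ∧ Matches S A r then (1 / 4 : ℝ) else 1)
  rw [Fintype.piFinset_univ] at h2
  rw [← h2]
  have h3 : ∀ u : Fin n, (∑ r : Fin n → Bool, if u ∉ S ∧ Matches S A r then (1 / 4 : ℝ) else 1)
      = if u ∈ S then 2 ^ n else 2 ^ n - 3 / 4 * (2 * 2 ^ (n - S.card)) := by
    intro u
    by_cases hu : u ∈ S
    · simp [hu]
    · have h4 := card_matches A hS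
      have h5 : ∀ r : Fin n → Bool, (if u ∉ S ∧ Matches S A r then (1 / 4 : ℝ) else 1)
          = 1 - 3 / 4 * (if Matches S A r then 1 else 0) := by
        intro r
        by_cases hr : Matches S A r
        · simp only [hu, hr, not_false_eq_true, and_self, if_true]; norm_num
        · simp [hr]
      simp only [h5]
      rw [if_neg hu, Finset.sum_sub_distrib, ← Finset.mul_sum, Finset.sum_boole, h4]
      simp
  simp only [h3]
  rw [Finset.prod_ite]
  simp only [Finset.prod_const]
  rw [Finset.filter_not, Finset.filter_mem_eq_inter, Finset.univ_inter,
    Finset.card_sdiff_of_subset (Finset.subset_univ _), Finset.card_univ, Fintype.card_fin]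

theorem sq_lt_two_pow {k : ℕ} (hk : 28 ≤ k) : 272 * k ^ 2 < 2 ^ k := by
  induction k, hk using Nat.le_induction with
  | base => norm_num
  | succ k hk ih => rw [pow_succ 2]; nlinarith

/-- The union bound for the random tournament. -/
theorem union_bound {k n : ℕ} (hk : 28 ≤ k) (hn : n = (k - 2) * k * 2 ^ k) :
    ((n : ℝ) ^ k * 2 ^ k) * (4 ^ k * (1 - 3 / 4 * (2 * (1 / 2) ^ k)) ^ (n - k)) < 1 := by
  have hkn : k ≤ n := by
    rw [hn]
    have : 1 ≤ (k - 2) * 2 ^ k := Nat.mul_pos (by omega) (by positivity)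
    calc k = 1 * k := by simp
      _ ≤ ((k - 2) * 2 ^ k) * k := Nat.mul_le_mul_right _ this
      _ = _ := by ring
  have hkR : (28 : ℝ) ≤ k := by exact_mod_cast hk
  have hnR : (n : ℝ) = (k - 2) * k * 2 ^ k := by
    rw [hn]; push_cast [Nat.cast_sub (show 2 ≤ k by omega)]; ring
  have hhalf : ((1 : ℝ) / 2) ^ k * 2 ^ k = 1 := by rw [← mul_pow]; norm_num
  have hhalf1 : ((1 : ℝ) / 2) ^ k ≤ 1 / 4 := by
    calc ((1 : ℝ) / 2) ^ k ≤ (1 / 2) ^ 2 := pow_le_pow_of_le_one (by norm_num) (by norm_num) (by omega)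
      _ = 1 / 4 := by norm_num
  have hpos : (0 : ℝ) < (1 / 2) ^ k := by positivity
  set p : ℝ := (1 / 2) ^ k with hp
  -- Here `n p = (k - 2) k`; the `k` subtracted from `n` costs `3/2 * p * k`, at most `k / 2`
  -- because `p ≤ 1/4`.
  have h1 : (1 - 3 / 4 * (2 * p)) ^ (n - k) ≤ Real.exp (-(3 / 2 * (k - 2) - 1 / 2)) ^ k := by
    have h0 : 1 - 3 / 4 * (2 * p) ≤ Real.exp (-(3 / 2 * p)) := by
      have := Real.add_one_le_exp (-(3 / 2 * p)); linarith
    calc (1 - 3 / 4 * (2 * p)) ^ (n - k) ≤ Real.exp (-(3 / 2 * p)) ^ (n - k) :=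
          pow_le_pow_left₀ (by linarith) h0 _
      _ ≤ _ := by
          rw [← Real.exp_nat_mul, ← Real.exp_nat_mul, Real.exp_le_exp, Nat.cast_sub hkn, hnR]
          have e : ((k - 2) * k * 2 ^ k - (k : ℝ)) * -(3 / 2 * p)
              = -(3 / 2) * ((k - 2) * k) * (p * 2 ^ k) + 3 / 2 * p * k := by ring
          rw [e, hhalf]
          nlinarith
  -- This is the `k`-th root of the goal, with `8 = 2 * 4`. By `e^(3/2) ≥ 4`, `e^(7/2) ≤ 34` and `n
  -- ≤ k^2 2^k` it reduces to `272 k^2 < 2^k`, where `272 = 8 * 34`.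
  have h2 : (8 : ℝ) * n * Real.exp (-(3 / 2 * (k - 2) - 1 / 2)) < 1 := by
    have he1 : (2.7182818283 : ℝ) < Real.exp 1 := Real.exp_one_gt_d9
    have he2 : Real.exp 1 < 2.7182818286 := Real.exp_one_lt_d9
    have e1 : Real.exp (-(3 / 2 * ((k : ℝ) - 2) - 1 / 2)) = Real.exp (7 / 2) * (Real.exp (3 / 2) ^ k)⁻¹ := by
      rw [← Real.exp_nat_mul, ← Real.exp_neg, ← Real.exp_add]; congr 1; ring
    have s1 : Real.exp (3 / 2) ^ 2 = Real.exp 1 ^ 3 := by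
      rw [← Real.exp_nat_mul, ← Real.exp_nat_mul]; norm_num
    have s2 : Real.exp (7 / 2) ^ 2 = Real.exp 1 ^ 7 := by
      rw [← Real.exp_nat_mul, ← Real.exp_nat_mul]; norm_num
    have b1 : (4 : ℝ) ≤ Real.exp (3 / 2) := by
      refine le_of_pow_le_pow_left₀ two_ne_zero (Real.exp_pos _).le ?_
      rw [s1]
      calc (4 : ℝ) ^ 2 ≤ 2.7 ^ 3 := by norm_num
        _ ≤ _ := pow_le_pow_left₀ (by norm_num) (by linarith) _
    have b2 : Real.exp (7 / 2) ≤ 34 := by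
      refine le_of_pow_le_pow_left₀ two_ne_zero (by norm_num) ?_
      rw [s2]
      calc Real.exp 1 ^ 7 ≤ 2.72 ^ 7 := pow_le_pow_left₀ (Real.exp_pos _).le (by linarith) _
        _ ≤ 34 ^ 2 := by norm_num
    have b3 : (272 : ℝ) * k ^ 2 < 2 ^ k := by exact_mod_cast sq_lt_two_pow hk
    have b4 : (4 : ℝ) ^ k ≤ Real.exp (3 / 2) ^ k := pow_le_pow_left₀ (by norm_num) b1 _
    have b5 : (4 : ℝ) ^ k = 2 ^ k * 2 ^ k := by rw [← mul_pow]; norm_num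
    rw [e1, ← mul_assoc, ← div_eq_mul_inv, div_lt_one (by positivity)]
    have p2 : (0 : ℝ) < 2 ^ k := by positivity
    calc 8 * (n : ℝ) * Real.exp (7 / 2) ≤ 8 * n * 34 := by gcongr
      _ = 272 * ((k - 2) * k) * 2 ^ k := by rw [hnR]; ring
      _ ≤ (272 * k ^ 2) * 2 ^ k := by
          refine mul_le_mul_of_nonneg_right ?_ p2.le
          nlinarith
      _ < 2 ^ k * 2 ^ k := mul_lt_mul_of_pos_right b3 p2
      _ ≤ _ := b5 ▸ b4
  have h3 : (n : ℝ) ^ k * 2 ^ k * (4 ^ k * Real.exp (-(3 / 2 * (k - 2) - 1 / 2)) ^ k)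
      = (8 * n * Real.exp (-(3 / 2 * (k - 2) - 1 / 2))) ^ k := by
    rw [← mul_pow, ← mul_pow, ← mul_pow]; congr 1; ring
  calc _ ≤ (n : ℝ) ^ k * 2 ^ k * (4 ^ k * Real.exp (-(3 / 2 * (k - 2) - 1 / 2)) ^ k) := by
        gcongr
    _ < 1 := by
        rw [h3]
        exact pow_lt_one₀ (by positivity) h2 (by omega)

/-- Markov's inequality for the weight `(1/4)^card`, with a union bound over at most `n^k` sets `S`
and the `2^k` subsets `A` of each. -/
theorem exists_tournament {k n : ℕ} (hk : 28 ≤ k) (hn : n = (k - 2) * k * 2 ^ k) :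
    ∃ t : Fin n → Fin n → Bool, (∀ x y, x ≠ y → t y x = !t x y) ∧
      ∀ S A : Finset (Fin n), S.card = k → A ⊆ S → k + 1 ≤ (matchSet t S A).card := by
  classical
  by_contra! hcon
  have hbad : ∀ f : Fin n → Fin n → Bool, ∃ S A : Finset (Fin n), S.card = k ∧ A ⊆ S ∧
      (matchSet (tournamentOf f) S A).card ≤ k := by
    intro f
    obtain ⟨S, A, h1, h2, h3⟩ := hcon (tournamentOf f) fun x y h => tournamentOf_swap f h
    exact ⟨S, A, h1, h2, by omega⟩
  set w : ℝ := (1 - 3 / 4 * (2 * (1 / 2) ^ k)) ^ (n - k) with hw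
  have hkn : ∀ S : Finset (Fin n), S.card = k → k ≤ n := fun S h => by
    simpa [h] using S.card_le_univ
  have hsum : ∀ S A : Finset (Fin n), S.card = k →
      ∑ f : Fin n → Fin n → Bool, (1 / 4 : ℝ) ^ (matchSet (tournamentOf f) S A).card
        = (2 ^ n) ^ n * w := by
    intro S A hS
    rw [sum_weight_matchSet A (Finset.card_pos.1 (by omega)), hS]
    have hk' := hkn S hS
    have e : (2 : ℝ) ^ n - 3 / 4 * (2 * 2 ^ (n - k))
        = 2 ^ n * (1 - 3 / 4 * (2 * (1 / 2) ^ k)) := by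
      have : (2 : ℝ) ^ n * (1 / 2) ^ k = 2 ^ (n - k) := by
        conv_lhs => rw [← Nat.sub_add_cancel hk', pow_add, mul_assoc, ← mul_pow]
        norm_num
      rw [← this]; ring
    rw [e, mul_pow, ← mul_assoc, ← pow_add, Nat.add_sub_cancel' hk']
  -- A pair with at most `k` matches has `4^k (1/4)^card ≥ 1`, so each tournament contributes at
  -- least 1.
  have hlow : ((2 : ℝ) ^ n) ^ n ≤ ∑ f : Fin n → Fin n → Bool,
      ∑ S ∈ Finset.powersetCard k (Finset.univ : Finset (Fin n)), ∑ A ∈ S.powerset,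
        4 ^ k * (1 / 4 : ℝ) ^ (matchSet (tournamentOf f) S A).card := by
    have hc : ((2 : ℝ) ^ n) ^ n = ∑ f : Fin n → Fin n → Bool, (1 : ℝ) := by simp
    rw [hc]
    refine Finset.sum_le_sum fun f _ => ?_
    obtain ⟨S, A, h1, h2, h3⟩ := hbad f
    calc (1 : ℝ) = 4 ^ k * (1 / 4) ^ k := by rw [← mul_pow]; norm_num
      _ ≤ 4 ^ k * (1 / 4 : ℝ) ^ (matchSet (tournamentOf f) S A).card := by
          refine mul_le_mul_of_nonneg_left ?_ (by positivity)
          exact pow_le_pow_of_le_one (by norm_num) (by norm_num) h3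
      _ ≤ ∑ A ∈ S.powerset, 4 ^ k * (1 / 4 : ℝ) ^ (matchSet (tournamentOf f) S A).card :=
          Finset.single_le_sum
            (f := fun A => 4 ^ k * (1 / 4 : ℝ) ^ (matchSet (tournamentOf f) S A).card)
            (fun _ _ => by positivity) (Finset.mem_powerset.2 h2)
      _ ≤ _ := Finset.single_le_sum
            (f := fun S => ∑ A ∈ S.powerset,
              4 ^ k * (1 / 4 : ℝ) ^ (matchSet (tournamentOf f) S A).card)
            (fun _ _ => by positivity)
            (Finset.mem_powersetCard.2 ⟨Finset.subset_univ _, h1⟩)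
  rw [Finset.sum_comm] at hlow
  have hup : ∀ S ∈ Finset.powersetCard k (Finset.univ : Finset (Fin n)),
      ∑ f : Fin n → Fin n → Bool, ∑ A ∈ S.powerset,
        4 ^ k * (1 / 4 : ℝ) ^ (matchSet (tournamentOf f) S A).card
      = 2 ^ k * (4 ^ k * ((2 ^ n) ^ n * w)) := by
    intro S hS
    have hS := (Finset.mem_powersetCard.1 hS).2
    rw [Finset.sum_comm]
    simp only [← Finset.mul_sum, hsum S _ hS, Finset.sum_const, Finset.card_powerset, hS,
      nsmul_eq_mul]
    push_cast; ring
  rw [Finset.sum_congr rfl hup, Finset.sum_const, Finset.card_powersetCard, Finset.card_univ,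
    Fintype.card_fin, nsmul_eq_mul] at hlow
  have hw0 : 0 ≤ w := by
    refine pow_nonneg ?_ _
    have : ((1 : ℝ) / 2) ^ k ≤ (1 / 2) ^ 2 :=
      pow_le_pow_of_le_one (by norm_num) (by norm_num) (by omega)
    norm_num at this ⊢
    linarith
  have hch : (n.choose k : ℝ) ≤ (n : ℝ) ^ k := by exact_mod_cast Nat.choose_le_pow n k
  have hub := union_bound hk hn
  have hN : (0 : ℝ) < (2 ^ n) ^ n := by positivity
  have : (n.choose k : ℝ) * (2 ^ k * (4 ^ k * ((2 ^ n) ^ n * w)))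
      ≤ (n : ℝ) ^ k * (2 ^ k * (4 ^ k * ((2 ^ n) ^ n * w))) := by gcongr
  have e : (n : ℝ) ^ k * (2 ^ k * (4 ^ k * ((2 ^ n) ^ n * w)))
      = ((n : ℝ) ^ k * 2 ^ k * (4 ^ k * w)) * (2 ^ n) ^ n := by ring
  have := mul_lt_mul_of_pos_right hub hN
  rw [← hw] at this
  linarith

/-- Richness of a tournament for sets of `k` vertices passes to smaller sets. -/
theorem two_pow_mul_le_card_matchSet {k K n : ℕ} {t : Fin n → Fin n → Bool} (hkn : k ≤ n)
    (ht : ∀ S A : Finset (Fin n), S.card = k → A ⊆ S → K ≤ (matchSet t S A).card) (m : ℕ) :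
    ∀ S A : Finset (Fin n), S.Nonempty → S.card + m = k → A ⊆ S →
      2 ^ m * K ≤ (matchSet t S A).card := by
  classical
  induction m with
  | zero => intro S A _ hS hA; simpa using ht S A hS hA
  | succ m ih =>
    intro S A hne hS hA
    obtain ⟨x, hx⟩ : ∃ x, x ∉ S := by
      by_contra! h
      have : S.card = n := by rw [Finset.eq_univ_iff_forall.2 h]; simp
      omega
    have hcard : (insert x S).card + m = k := by rw [Finset.card_insert_of_notMem hx]; omega
    -- The matches for `(S, A)` include those extending to `x` with `x` outside the pattern and
    -- those with `x` inside it; each kind is bounded by induction.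
    have h1 := ih (insert x S) A (Finset.insert_nonempty _ _) hcard
      (hA.trans (Finset.subset_insert _ _))
    have h2 := ih (insert x S) (insert x A) (Finset.insert_nonempty _ _) hcard
      (Finset.insert_subset_insert _ hA)
    have hxA : x ∉ A := fun h => hx (hA h)
    -- An element of `S` fixes the push bit, so the entry at `x` separates the two kinds. For empty
    -- `S` they would coincide.
    have hdisj : Disjoint (matchSet t (insert x S) A) (matchSet t (insert x S) (insert x A)) := by
      rw [Finset.disjoint_left]
      intro u h1 h2
      rw [mem_matchSet] at h1 h2
      obtain ⟨-, b, hb⟩ := h1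
      obtain ⟨-, c, hc⟩ := h2
      obtain ⟨y, hy⟩ := hne
      have b1 := hb x (Finset.mem_insert_self _ _)
      have c1 := hc x (Finset.mem_insert_self _ _)
      have b2 := hb y (Finset.mem_insert_of_mem hy)
      have c2 := hc y (Finset.mem_insert_of_mem hy)
      have hyx : y ≠ x := fun h => hx (h ▸ hy)
      simp only [Finset.mem_insert, hyx, false_or, true_or, iff_true, hxA, iff_false] at b1 c1 b2 c2
      by_cases hyA : y ∈ A
      · rw [iff_true_right hyA] at b2 c2
        exact b1 (c1.trans (c2.symm.trans b2))
      · rw [iff_false_right hyA] at b2 c2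
        revert b1 c1 b2 c2
        cases t u x <;> cases t u y <;> cases b <;> cases c <;> simp
    have hsub : matchSet t (insert x S) A ∪ matchSet t (insert x S) (insert x A)
        ⊆ matchSet t S A := by
      intro u hu
      rw [Finset.mem_union, mem_matchSet, mem_matchSet] at hu
      rw [mem_matchSet]
      rcases hu with ⟨h1, b, hb⟩ | ⟨h1, b, hb⟩
      · exact ⟨fun h => h1 (Finset.mem_insert_of_mem h), b,
          fun y hy => hb y (Finset.mem_insert_of_mem hy)⟩
      · refine ⟨fun h => h1 (Finset.mem_insert_of_mem h), b, fun y hy => ?_⟩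
        rw [hb y (Finset.mem_insert_of_mem hy), Finset.mem_insert, or_iff_right]
        exact fun h => hx (h ▸ hy)
    calc 2 ^ (m + 1) * K = 2 ^ m * K + 2 ^ m * K := by ring
      _ ≤ _ := Nat.add_le_add h1 h2
      _ = _ := (Finset.card_union_of_disjoint hdisj).symm
      _ ≤ _ := Finset.card_le_card hsub

/-! ### Pushes as sign functions -/

namespace OrientedGraph

theorem PushRelated.exists_sign {V : Type u} {D D' : OrientedGraph V} (h : D.PushRelated D') :
    ∃ s : V → Bool, ∀ x y, D'.Adj x y ↔ if s x = s y then D.Adj x y else D.Adj y x := by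
  classical
  induction h with
  | refl => exact ⟨fun _ => false, fun x y => by simp⟩
  | @tail D₁ D₂ _ h ih =>
    obtain ⟨z, rfl⟩ := h
    obtain ⟨s, hs⟩ := ih
    refine ⟨fun v => if v = z then !s v else s v, fun x y => ?_⟩
    have hz : ¬ D.Adj z z := fun h => D.asymm z z h h
    by_cases hx : x = z <;> by_cases hy : y = z
    · subst hx hy
      simp [push, hs, hz]
    · subst hx
      cases h1 : s x <;> cases h2 : s y <;> simp [push, hs, hy, h1, h2]
    · subst hy
      cases h1 : s x <;> cases h2 : s y <;> simp [push, hs, hx, h1, h2]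
    · simp [push, hs, hx, hy]

theorem exists_pushRelated_of_finset {V : Type u} (D : OrientedGraph V) (A : Finset V) :
    ∃ D' : OrientedGraph V, D.PushRelated D' ∧
      ∀ x y, D'.Adj x y ↔ ((x ∈ A ↔ y ∈ A) ∧ D.Adj x y ∨ ¬ (x ∈ A ↔ y ∈ A) ∧ D.Adj y x) := by
  classical
  induction A using Finset.induction_on with
  | empty => exact ⟨D, Relation.ReflTransGen.refl, by simp⟩
  | insert z A hz ih =>
    obtain ⟨D', h1, h2⟩ := ih
    refine ⟨D'.push z, h1.tail ⟨z, rfl⟩, fun x y => ?_⟩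
    have hzz : ¬ D.Adj z z := fun h => D.asymm z z h h
    by_cases hx : x = z <;> by_cases hy : y = z
    · subst hx hy
      simp [push, h2, hzz]
    · subst hx
      simp [push, h2, hz, hy]
      tauto
    · subst hy
      simp [push, h2, hz, hx]
      tauto
    · simp [push, h2, hx, hy]

/-- Only the parity of the pushes at each vertex matters: an arc is reversed exactly when its ends
have different parities. On a finite vertex set every sign function is realised by pushes. -/
theorem isPushableHom_iff {V : Type u} {W : Type v} [Finite V] {D : OrientedGraph V}
    {H : OrientedGraph W} {φ : V → W} : D.IsPushableHom H φ ↔ ∃ s : V → Bool, ∀ x y, D.Adj x y →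
      if s x = s y then H.Adj (φ x) (φ y) else H.Adj (φ y) (φ x) := by
  classical
  have := Fintype.ofFinite V
  constructor
  · rintro ⟨D', h, hφ⟩
    obtain ⟨s, hs⟩ := h.exists_sign
    refine ⟨s, fun x y hxy => ?_⟩
    split_ifs with h
    · exact hφ x y ((hs x y).2 (by rwa [if_pos h]))
    · exact hφ y x ((hs y x).2 (by rwa [if_neg (Ne.symm h)]))
  · rintro ⟨s, hs⟩
    obtain ⟨D', h1, h2⟩ := D.exists_pushRelated_of_finset (Finset.univ.filter fun x => s x = true)
    refine ⟨D', h1, fun x y hxy => ?_⟩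
    have e : (s x = true ↔ s y = true) ↔ s x = s y := by cases s x <;> cases s y <;> simp
    rw [h2, Finset.mem_filter_univ, Finset.mem_filter_univ, e] at hxy
    rcases hxy with ⟨h, h'⟩ | ⟨h, h'⟩
    · simpa [h] using hs x y h'
    · simpa [Ne.symm h] using hs y x h'

/-- The image of an oriented graph under an embedding of its vertex set. -/
def map {V : Type u} {W : Type v} (H : OrientedGraph V) (f : V ↪ W) : OrientedGraph W where
  Adj x y := ∃ a b, H.Adj a b ∧ f a = x ∧ f b = y
  asymm := by
    rintro _ _ ⟨a, b, h, rfl, rfl⟩ ⟨c, d, h', hc, hd⟩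
    obtain rfl := f.injective hc
    obtain rfl := f.injective hd
    exact H.asymm _ _ h h'

/-- Isolated vertices may be added to the target, so larger orders are admissible too. -/
theorem IsPushableHom.mem_pushableOrders {V : Type u} {W : Type v} [Fintype W]
    {D : OrientedGraph V} {H : OrientedGraph W} {φ : V → W} (h : D.IsPushableHom H φ) {m : ℕ}
    (hm : Fintype.card W ≤ m) : m ∈ D.pushableOrders := by
  obtain ⟨f⟩ : Nonempty (W ↪ Fin m) := Function.Embedding.nonempty_of_card_le (by simpa using hm)
  obtain ⟨D', h1, h2⟩ := h
  exact ⟨H.map f, f ∘ φ, D', h1, fun x y hxy => ⟨_, _, h2 x y hxy, rfl, rfl⟩⟩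

end OrientedGraph

/-! ### Greedy colouring towards a root, and the upper bound for one orientation -/

/-- `φ` and `s` form a pushable homomorphism to the tournament `t` on the set `C`, such that the
neighbours in `C` of a vertex outside `C` have distinct images. -/
structure IsPartialColouring {V : Type u} (D : OrientedGraph V) {n : ℕ}
    (t : Fin n → Fin n → Bool) (C : Finset V) (φ : V → Fin n) (s : V → Bool) : Prop where
  arc : ∀ x ∈ C, ∀ y ∈ C, D.Adj x y → φ x ≠ φ y ∧ t (φ x) (φ y) = (s x == s y)
  inj : ∀ w ∉ C, ∀ x ∈ C, ∀ y ∈ C, D.underlying.Adj w x → D.underlying.Adj w y →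
    φ x = φ y → x = y

theorem succ_mul_lt_two_pow_mul (m k : ℕ) : (m + 1) * k < 2 ^ m * (k + 1) := by
  have h : m + 1 ≤ 2 ^ m := Nat.lt_two_pow_self
  nlinarith

open Classical in
-- If `v` has `k - m` coloured neighbours, it has at most `m + 1` uncoloured ones, which forbid at
-- most `(m + 1) k` colours. Richness offers at least `2^m (k + 1)`, which is more.
theorem IsPartialColouring.exists_insert {V : Type u} [Fintype V] {D : OrientedGraph V} {k n : ℕ}
    {t : Fin n → Fin n → Bool} (hn : (k + 1) * k < n) (hanti : ∀ x y, x ≠ y → t y x = !t x y)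
    (ht : ∀ m, ∀ S A : Finset (Fin n), S.Nonempty → S.card + m = k → A ⊆ S →
      2 ^ m * (k + 1) ≤ (matchSet t S A).card)
    (hdeg : ∀ v, D.underlying.degree v ≤ k + 1) {C : Finset V} {φ : V → Fin n} {s : V → Bool}
    (h : IsPartialColouring D t C φ s) {v : V} (hv : v ∉ C)
    (hw : ∃ w, D.underlying.Adj v w ∧ w ∉ C) :
    ∃ φ' s', IsPartialColouring D t (insert v C) φ' s' := by
  set G := D.underlying with hG
  set P := G.neighborFinset v ∩ C with hP
  set Q := G.neighborFinset v \ C with hQ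
  have hPQ : P.card + Q.card = G.degree v := Finset.card_inter_add_card_sdiff _ _
  have hQ1 : 1 ≤ Q.card := by
    obtain ⟨w, h1, h2⟩ := hw
    exact Finset.card_pos.2 ⟨w, by simp [hQ, h1, h2]⟩
  have hmemP : ∀ {x}, x ∈ P ↔ G.Adj v x ∧ x ∈ C := by simp [hP]
  obtain ⟨m, hm⟩ : ∃ m, P.card + m = k := ⟨k - P.card, by have := hdeg v; omega⟩
  -- Colours that would be repeated around some uncoloured neighbour of `v`.
  set F := (Q.biUnion fun w => G.neighborFinset w ∩ C).image φ with hF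
  have hFcard : F.card ≤ (m + 1) * k := by
    refine Finset.card_image_le.trans (Finset.card_biUnion_le.trans ?_)
    calc _ ≤ ∑ w ∈ Q, k := by
          refine Finset.sum_le_sum fun w hw => ?_
          have hvw : v ∈ G.neighborFinset w := by
            simp only [hQ, Finset.mem_sdiff, SimpleGraph.mem_neighborFinset] at hw ⊢
            exact hw.1.symm
          -- The uncoloured `v` is itself a neighbour of `w`, which leaves at most `k` coloured
          -- ones.
          have : G.neighborFinset w ∩ C ⊆ (G.neighborFinset w).erase v := fun x hx =>
            Finset.mem_erase.2 ⟨fun e => hv (e ▸ (Finset.mem_inter.1 hx).2),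
              (Finset.mem_inter.1 hx).1⟩
          have h2 := Finset.card_le_card this
          rw [Finset.card_erase_of_mem hvw, SimpleGraph.card_neighborFinset_eq_degree] at h2
          have := hdeg w
          omega
      _ = Q.card * k := by simp
      _ ≤ (m + 1) * k := by
          refine Nat.mul_le_mul_right _ ?_
          have := hdeg v
          omega
  have hinjP : Set.InjOn φ P := fun x hx y hy e =>
    h.inj v hv x (hmemP.1 hx).2 y (hmemP.1 hy).2 (hmemP.1 hx).1 (hmemP.1 hy).1 e
  have key : ∃ (u : Fin n) (b : Bool), u ∉ F ∧ ∀ x ∈ P, u ≠ φ x ∧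
      (t u (φ x) = b ↔ (if D.Adj v x then s x = false else s x = true)) := by
    -- Richness needs a nonempty set; with no coloured neighbour, any colour outside `F` works, and
    -- `hn` provides one.
    rcases P.eq_empty_or_nonempty with hPe | hPne
    · obtain ⟨u, -, hu⟩ := Finset.exists_mem_notMem_of_card_lt_card
        (s := F) (t := (Finset.univ : Finset (Fin n))) (by
          rw [hPe, Finset.card_empty, zero_add] at hm
          rw [Finset.card_univ, Fintype.card_fin]
          subst hm
          omega)
      exact ⟨u, true, hu, by simp [hPe]⟩
    · set A := (P.filter fun x => if D.Adj v x then s x = false else s x = true).image φ with hA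
      obtain ⟨u, hu, huF⟩ := Finset.exists_mem_notMem_of_card_lt_card
        (s := F) (t := matchSet t (P.image φ) A) (by
          have := ht m (P.image φ) A (hPne.image _) (by rw [Finset.card_image_of_injOn hinjP, hm])
            (Finset.image_subset_image (Finset.filter_subset _ _))
          have := succ_mul_lt_two_pow_mul m k
          omega)
      obtain ⟨h1, b, hb⟩ := mem_matchSet.1 hu
      refine ⟨u, b, huF, fun x hx => ⟨fun e => h1 (e ▸ Finset.mem_image_of_mem _ hx), ?_⟩⟩
      rw [hb _ (Finset.mem_image_of_mem _ hx), hA, Finset.mem_image]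
      constructor
      · rintro ⟨y, hy, e⟩
        rw [Finset.mem_filter] at hy
        rw [← hinjP hy.1 hx e]
        exact hy.2
      · exact fun hx' => ⟨x, Finset.mem_filter.2 ⟨hx, hx'⟩, rfl⟩
  obtain ⟨u, b, huF, hu⟩ := key
  have hne : ∀ {x}, x ∈ C → x ≠ v := fun hx e => hv (e ▸ hx)
  -- The sign `!b` makes `t u (φ x) = b` the requirement on out-neighbours of sign `false` and
  -- in-neighbours of sign `true`.
  refine ⟨Function.update φ v u, Function.update s v (!b), ?_, ?_⟩
  · intro x hx' y hy' hxy
    rcases Finset.mem_insert.1 hx' with rfl | hx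
    · rcases Finset.mem_insert.1 hy' with rfl | hy
      · exact absurd hxy (D.asymm _ _ hxy)
      · obtain ⟨h1, h2⟩ := hu y (hmemP.2 ⟨Or.inl hxy, hy⟩)
        rw [if_pos hxy] at h2
        simp only [Function.update_self, Function.update_of_ne (hne hy)]
        refine ⟨h1, ?_⟩
        cases b <;> cases h3 : s y <;> simp_all
    · rcases Finset.mem_insert.1 hy' with rfl | hy
      · obtain ⟨h1, h2⟩ := hu x (hmemP.2 ⟨Or.inr hxy, hx⟩)
        rw [if_neg (D.asymm _ _ hxy)] at h2
        simp only [Function.update_self, Function.update_of_ne (hne hx)]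
        refine ⟨h1.symm, ?_⟩
        rw [hanti _ _ h1]
        cases b <;> cases h3 : s x <;> simp_all
      · simp only [Function.update_of_ne (hne hx), Function.update_of_ne (hne hy)]
        exact h.arc x hx y hy hxy
  · intro w hw
    have hwv : w ≠ v := fun e => hw (e ▸ Finset.mem_insert_self _ _)
    have hwC : w ∉ C := fun e => hw (Finset.mem_insert_of_mem e)
    have aux : ∀ y ∈ C, G.Adj w v → G.Adj w y → u ≠ φ y := fun y hy h1 h2 e =>
      huF (e ▸ Finset.mem_image_of_mem _ (Finset.mem_biUnion.2 ⟨w, by simp [hQ, h1.symm, hwC],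
        by simp [h2, hy]⟩))
    intro x hx' y hy' h1 h2 e
    rcases Finset.mem_insert.1 hx' with rfl | hx
    · rcases Finset.mem_insert.1 hy' with rfl | hy
      · rfl
      · rw [Function.update_self, Function.update_of_ne (hne hy)] at e
        exact absurd e (aux y hy h1 h2)
    · rcases Finset.mem_insert.1 hy' with rfl | hy
      · rw [Function.update_self, Function.update_of_ne (hne hx)] at e
        exact absurd e.symm (aux x hx h2 h1)
      · rw [Function.update_of_ne (hne hx), Function.update_of_ne (hne hy)] at e
        exact h.inj w hwC x hx y hy h1 h2 e

theorem SimpleGraph.Connected.exists_adj_dist_lt {V : Type u} {G : SimpleGraph V}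
    (hG : G.Connected) {v r : V} (h : v ≠ r) : ∃ w, G.Adj v w ∧ G.dist w r < G.dist v r := by
  obtain ⟨p, hp⟩ := hG.exists_walk_length_eq_dist v r
  cases p with
  | nil => exact absurd rfl h
  | cons hadj q =>
    refine ⟨_, hadj, ?_⟩
    have := SimpleGraph.dist_le q
    rw [SimpleGraph.Walk.length_cons] at hp
    omega

open Classical in
-- Always colour a farthest uncoloured vertex. The coloured set stays closed under moving away from
-- `r`, so a neighbour closer to `r` is still uncoloured, as the insertion step requires.
theorem exists_isPartialColouring_erase {V : Type u} [Fintype V] {D : OrientedGraph V} {k n : ℕ}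
    {t : Fin n → Fin n → Bool} (hn : (k + 1) * k < n) (hanti : ∀ x y, x ≠ y → t y x = !t x y)
    (ht : ∀ m, ∀ S A : Finset (Fin n), S.Nonempty → S.card + m = k → A ⊆ S →
      2 ^ m * (k + 1) ≤ (matchSet t S A).card)
    (hdeg : ∀ v, D.underlying.degree v ≤ k + 1) (hconn : D.underlying.Connected) (r : V) :
    ∃ φ s, IsPartialColouring D t (Finset.univ.erase r) φ s := by
  have step : ∀ m, m ≤ (Finset.univ.erase r).card → ∃ C : Finset V, C.card = m ∧ r ∉ C ∧
      (∀ x ∈ C, ∀ y, D.underlying.dist x r < D.underlying.dist y r → y ∈ C) ∧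
      ∃ φ s, IsPartialColouring D t C φ s := by
    intro m
    induction m with
    | zero =>
      exact fun _ => ⟨∅, rfl, by simp, by simp, fun _ => ⟨0, by omega⟩, fun _ => true,
        by simp, by simp⟩
    | succ m ih =>
      intro hm
      obtain ⟨C, hC, hr, hup, φ, s, h⟩ := ih (by omega)
      have hne : ((Finset.univ.erase r) \ C).Nonempty :=
        Finset.sdiff_nonempty_of_card_lt_card (by omega)
      obtain ⟨v, hv, hmax⟩ := Finset.exists_max_image _ (fun x => D.underlying.dist x r) hne
      simp only [Finset.mem_sdiff, Finset.mem_erase, Finset.mem_univ, and_true] at hv hmax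
      refine ⟨insert v C, by rw [Finset.card_insert_of_notMem hv.2, hC], ?_, ?_, ?_⟩
      · rw [Finset.mem_insert, not_or]
        exact ⟨hv.1.symm, hr⟩
      · intro x hx y hxy
        rcases Finset.mem_insert.1 hx with rfl | hx
        · by_contra hy
          rw [Finset.mem_insert, not_or] at hy
          have := hmax y ⟨fun e => by simp [e] at hxy, hy.2⟩
          omega
        · exact Finset.mem_insert_of_mem (hup x hx y hxy)
      · obtain ⟨w, hw, hlt⟩ := hconn.exists_adj_dist_lt hv.1
        exact h.exists_insert hn hanti ht hdeg hv.2 ⟨w, hw, fun hwC => hv.2 (hup w hwC v hlt)⟩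
  obtain ⟨C, hC, hr, -, h⟩ := step _ le_rfl
  have : C = Finset.univ.erase r :=
    Finset.eq_of_subset_of_card_le (fun x hx => Finset.mem_erase.2 ⟨fun e => hr (e ▸ hx),
      Finset.mem_univ _⟩) hC.ge
  rwa [this] at h

/-- The tournament `t` with one more vertex, whose out-neighbourhood is `γ`. -/
def apexTournament {n : ℕ} (t : Fin n → Fin n → Bool) (hanti : ∀ x y, x ≠ y → t y x = !t x y)
    (γ : Fin n → Prop) : OrientedGraph (Option (Fin n)) where
  Adj
    | some x, some y => x ≠ y ∧ t x y = true
    | none, some y => γ y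
    | some x, none => ¬ γ x
    | none, none => False
  asymm := by
    rintro (_ | x) (_ | y)
    · exact fun h _ => h
    · exact fun h h' => h' h
    · exact fun h h' => h h'
    · rintro ⟨h1, h2⟩ ⟨-, h3⟩
      rw [hanti x y h1, h2] at h3
      cases h3

open Classical in
theorem OrientedGraph.pushableChromaticNumber_le {V : Type u} [Fintype V] (D : OrientedGraph V)
    {k : ℕ} (hk : 28 ≤ k) (hdeg : ∀ v, D.underlying.degree v ≤ k + 1)
    (hconn : D.underlying.Connected) :
    D.pushableChromaticNumber ≤ (k - 2) * k * 2 ^ k + 1 := by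
  obtain ⟨n, hn⟩ : ∃ n, n = (k - 2) * k * 2 ^ k := ⟨_, rfl⟩
  obtain ⟨t, hanti, hrich⟩ := exists_tournament hk hn
  have hbig : (k + 1) * k < n := by
    have h1 := sq_lt_two_pow hk
    have h2 : 1 * 1 ≤ (k - 2) * k := Nat.mul_le_mul (by omega) (by omega)
    have h3 := Nat.mul_le_mul_right (2 ^ k) h2
    nlinarith
  have hkn : k ≤ n := by nlinarith
  obtain ⟨r⟩ := hconn.nonempty
  obtain ⟨φ, s, h⟩ := exists_isPartialColouring_erase hbig hanti
    (fun m => two_pow_mul_le_card_matchSet hkn hrich m) hdeg hconn r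
  have hC : ∀ {x}, x ≠ r → x ∈ Finset.univ.erase r := fun hx =>
    Finset.mem_erase.2 ⟨hx, Finset.mem_univ _⟩
  set γ : Fin n → Prop := fun c => ∃ w, w ≠ r ∧ φ w = c ∧
    (D.Adj r w ∧ s w = false ∨ D.Adj w r ∧ s w = true) with hγ
  have hγ' : ∀ w, w ≠ r → D.underlying.Adj r w →
      (γ (φ w) ↔ D.Adj r w ∧ s w = false ∨ D.Adj w r ∧ s w = true) := by
    -- The apex arcs are well defined because the neighbours of the uncoloured root have distinct
    -- images.
    intro w hw hrw
    refine ⟨?_, fun h' => ⟨w, hw, rfl, h'⟩⟩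
    rintro ⟨w', h1, h2, h3⟩
    have : w' = w := h.inj r (by simp) w' (hC h1) w (hC hw)
      (h3.imp And.left And.left) hrw h2
    rwa [this] at h3
  have hom : D.IsPushableHom (apexTournament t hanti γ)
      (fun x => if x = r then none else some (φ x)) := by
    rw [OrientedGraph.isPushableHom_iff]
    refine ⟨Function.update s r false, fun x y hxy => ?_⟩
    have has := D.asymm _ _ hxy
    by_cases hx : x = r
    · subst hx
      have hy : y ≠ x := by rintro rfl; exact has hxy
      have := hγ' y hy (Or.inl hxy)
      cases h3 : s y <;> simp [hy, h3, apexTournament, this, hxy, has]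
    · by_cases hy : y = r
      · subst hy
        have := hγ' x hx (Or.inr hxy)
        cases h3 : s x <;> simp [hx, h3, apexTournament, this, hxy, has]
      · obtain ⟨h1, h2⟩ := h.arc x (hC hx) y (hC hy) hxy
        have h3 := hanti _ _ h1
        by_cases h4 : s x = s y
        · simp [hx, hy, h4, apexTournament, h1, h2]
        · simp [hx, hy, h4, apexTournament, Ne.symm h1, h3, h2]
  subst hn
  exact D.isLeast_pushableChromaticNumber.2 (hom.mem_pushableOrders (by simp))

/-! ### Bipartite circulants and the counting lower bound -/

/-- The circulant bipartite graph: `(i, false)` is adjacent to `(i + a, true)` for `a < Δ`. -/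
def bipartiteCirculant (Δ N : ℕ) : SimpleGraph (ULift.{u} (ZMod N × Bool)) where
  Adj x y := ∃ (i : ZMod N) (a : Fin Δ),
    x.down = (i, false) ∧ y.down = (i + (a : ℕ), true) ∨
    y.down = (i, false) ∧ x.down = (i + (a : ℕ), true)
  symm := ⟨fun _ _ ⟨i, a, h⟩ => ⟨i, a, h.symm⟩⟩
  loopless := ⟨by
    rintro x ⟨i, a, ⟨h1, h2⟩ | ⟨h1, h2⟩⟩ <;> simp [h1] at h2⟩

theorem natCast_fin_injective {Δ N : ℕ} (h : Δ ≤ N) :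
    Function.Injective fun a : Fin Δ => ((a : ℕ) : ZMod N) := by
  intro a b hab
  have := (ZMod.natCast_eq_natCast_iff' _ _ _).1 hab
  rw [Nat.mod_eq_of_lt (by omega), Nat.mod_eq_of_lt (by omega)] at this
  exact Fin.ext this

open Classical in
theorem bipartiteCirculant_degree {Δ N : ℕ} [NeZero N] (h : Δ ≤ N)
    (x : ULift.{u} (ZMod N × Bool)) : (bipartiteCirculant.{u} Δ N).degree x = Δ := by
  obtain ⟨i, c⟩ := x
  rw [← SimpleGraph.card_neighborFinset_eq_degree]
  have hinj := natCast_fin_injective h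
  cases c
  · have : (bipartiteCirculant.{u} Δ N).neighborFinset ⟨(i, false)⟩ = Finset.univ.image
        fun a : Fin Δ => (⟨(i + (a : ℕ), true)⟩ : ULift.{u} (ZMod N × Bool)) := by
      ext ⟨y⟩
      rw [SimpleGraph.mem_neighborFinset]
      simp [bipartiteCirculant, eq_comm]
    rw [this, Finset.card_image_of_injective _ fun a b hab => hinj (by simpa using hab),
      Finset.card_univ, Fintype.card_fin]
  · have : (bipartiteCirculant.{u} Δ N).neighborFinset ⟨(i, true)⟩ = Finset.univ.image
        fun a : Fin Δ => (⟨(i - (a : ℕ), false)⟩ : ULift.{u} (ZMod N × Bool)) := by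
      ext ⟨y⟩
      rw [SimpleGraph.mem_neighborFinset]
      simp only [bipartiteCirculant, Finset.mem_image, Finset.mem_univ, true_and, ULift.up_inj,
        Prod.mk.injEq]
      constructor
      · rintro ⟨j, a, h | ⟨h1, h2⟩⟩
        · simp at h
        · exact ⟨a, by rw [h1, h2.1]; simp⟩
      · rintro ⟨a, rfl⟩
        exact ⟨i - (a : ℕ), a, Or.inr ⟨rfl, by simp⟩⟩
    rw [this, Finset.card_image_of_injective _ fun a b hab => hinj (by simpa using hab),
      Finset.card_univ, Fintype.card_fin]

/-- The shifts 0 and 1 already give a path through all residues. -/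
theorem bipartiteCirculant_connected {Δ N : ℕ} [NeZero N] (h : 2 ≤ Δ) :
    (bipartiteCirculant.{u} Δ N).Connected := by
  have h0 : ∀ i : ZMod N, (bipartiteCirculant.{u} Δ N).Adj ⟨(i, false)⟩ ⟨(i, true)⟩ :=
    fun i => ⟨i, ⟨0, by omega⟩, Or.inl ⟨rfl, by simp⟩⟩
  have h1 : ∀ i : ZMod N, (bipartiteCirculant.{u} Δ N).Adj ⟨(i, false)⟩ ⟨(i + 1, true)⟩ :=
    fun i => ⟨i, ⟨1, by omega⟩, Or.inl ⟨rfl, by simp⟩⟩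
  have hn : ∀ m : ℕ, (bipartiteCirculant.{u} Δ N).Reachable ⟨(0, false)⟩ ⟨((m : ZMod N), false)⟩ := by
    intro m
    induction m with
    | zero => simp
    | succ m ih =>
      refine ih.trans ((h1 _).reachable.trans ?_)
      rw [Nat.cast_succ]
      exact (h0 _).symm.reachable
  have hr : ∀ x, (bipartiteCirculant.{u} Δ N).Reachable ⟨(0, false)⟩ x := by
    rintro ⟨i, c⟩
    have := hn i.val
    rw [ZMod.natCast_zmod_val] at this
    cases c
    · exact this
    · exact this.trans (h0 i).reachable
  have : Nonempty (ULift.{u} (ZMod N × Bool)) := ⟨⟨(0, false)⟩⟩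
  exact ⟨fun x y => (hr x).symm.trans (hr y)⟩

/-- The orientation of the circulant bipartite graph given by a Boolean for every edge. -/
def circulantOrientation {Δ N : ℕ} (h : Δ ≤ N) (f : ZMod N → Fin Δ → Bool) :
    OrientedGraph (ULift.{u} (ZMod N × Bool)) where
  Adj x y := ∃ (i : ZMod N) (a : Fin Δ),
    x.down = (i, false) ∧ y.down = (i + (a : ℕ), true) ∧ f i a = true ∨
    y.down = (i, false) ∧ x.down = (i + (a : ℕ), true) ∧ f i a = false
  asymm := by
    rintro x y ⟨i, a, h1⟩ ⟨j, b, h2⟩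
    rcases h1 with ⟨h1, h3, h5⟩ | ⟨h1, h3, h5⟩ <;> rcases h2 with ⟨h2, h4, h6⟩ | ⟨h2, h4, h6⟩
    · simp [h3] at h2
    · obtain rfl : i = j := by simpa [h1] using h2
      obtain rfl : a = b := natCast_fin_injective h (by simpa [h3] using h4)
      simp [h5] at h6
    · obtain rfl : i = j := by simpa [h1] using h2
      obtain rfl : a = b := natCast_fin_injective h (by simpa [h3] using h4)
      simp [h5] at h6
    · simp [h3] at h2

theorem circulantOrientation_isOrientation {Δ N : ℕ} (h : Δ ≤ N) (f : ZMod N → Fin Δ → Bool) :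
    (circulantOrientation.{u} h f).IsOrientation (bipartiteCirculant Δ N) := by
  ext x y
  simp only [OrientedGraph.underlying, circulantOrientation, bipartiteCirculant]
  constructor
  · rintro (⟨i, a, h | h⟩ | ⟨i, a, h | h⟩)
    · exact ⟨i, a, Or.inl ⟨h.1, h.2.1⟩⟩
    · exact ⟨i, a, Or.inr ⟨h.1, h.2.1⟩⟩
    · exact ⟨i, a, Or.inr ⟨h.1, h.2.1⟩⟩
    · exact ⟨i, a, Or.inl ⟨h.1, h.2.1⟩⟩
  · rintro ⟨i, a, h⟩
    cases hf : f i a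
    · rcases h with h | h
      · exact Or.inr ⟨i, a, Or.inr ⟨h.1, h.2, hf⟩⟩
      · exact Or.inl ⟨i, a, Or.inr ⟨h.1, h.2, hf⟩⟩
    · rcases h with h | h
      · exact Or.inl ⟨i, a, Or.inl ⟨h.1, h.2, hf⟩⟩
      · exact Or.inr ⟨i, a, Or.inl ⟨h.1, h.2, hf⟩⟩

/-- Counting orientations against pushable homomorphisms to graphs of order `K`. -/
theorem two_pow_le_of_forall_mem_pushableOrders {Δ N K : ℕ} [NeZero N] (h : Δ ≤ N)
    (hK : ∀ f : ZMod N → Fin Δ → Bool, K ∈ (circulantOrientation.{u} h f).pushableOrders) :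
    (2 ^ Δ) ^ N ≤ 2 ^ (K * K) * (4 * K ^ 2) ^ N := by
  classical
  -- The target relation, the map and the signs recover `f`; asymmetry of the target gives the
  -- implication from right to left.
  have hex : ∀ f : ZMod N → Fin Δ → Bool,
      ∃ p : (Fin K × Fin K → Prop) × (ULift.{u} (ZMod N × Bool) → Fin K × Bool),
      ∀ i a, f i a = true ↔
        let x := p.2 ⟨(i, false)⟩
        let y := p.2 ⟨(i + ((a : Fin Δ) : ℕ), true)⟩
        if x.2 = y.2 then p.1 (x.1, y.1) else p.1 (y.1, x.1) := by
    intro f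
    obtain ⟨H, φ, hφ⟩ := hK f
    obtain ⟨s, hs⟩ := OrientedGraph.isPushableHom_iff.1 hφ
    refine ⟨(fun q => H.Adj q.1 q.2, fun x => (φ x, s x)), fun i a => ?_⟩
    cases hf : f i a
    · have := hs _ _ (show (circulantOrientation.{u} h f).Adj ⟨(i + ((a : Fin Δ) : ℕ), true)⟩
        ⟨(i, false)⟩ from ⟨i, a, Or.inr ⟨rfl, rfl, hf⟩⟩)
      dsimp only
      split_ifs with h1
      · rw [if_pos h1.symm] at this
        simpa using H.asymm _ _ this
      · rw [if_neg (Ne.symm h1)] at this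
        simpa using H.asymm _ _ this
    · have := hs _ _ (show (circulantOrientation.{u} h f).Adj ⟨(i, false)⟩
        ⟨(i + ((a : Fin Δ) : ℕ), true)⟩ from ⟨i, a, Or.inl ⟨rfl, rfl, hf⟩⟩)
      simpa using this
  choose p hp using hex
  have hinj : Function.Injective p := by
    intro f g e
    funext i a
    have h1 := hp f i a
    rw [e] at h1
    exact Bool.eq_iff_iff.2 (h1.trans (hp g i a).symm)
  have hcard := Fintype.card_le_of_injective p hinj
  simp only [Fintype.card_pi, Fintype.card_prod, Fintype.card_bool, Fintype.card_fin,
    Finset.prod_const, Finset.card_univ, ZMod.card, Fintype.card_ulift, Fintype.card_prop] at hcard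
  refine hcard.trans (le_of_eq ?_)
  rw [mul_comm N 2, pow_mul (K * 2), mul_pow K 2 2, mul_comm (K ^ 2)]
  norm_num

/-- If `a > b > 0`, the powers of `a / b` eventually exceed any constant `C`. -/
theorem le_of_forall_pow_le_mul_pow {a b C M : ℕ} (h : ∀ N, M ≤ N → a ^ N ≤ C * b ^ N) :
    a ≤ b := by
  by_contra! hlt
  rcases Nat.eq_zero_or_pos b with rfl | hb
  · have := h (M + 1) (by omega)
    simp at this
    omega
  have hb' : (0 : ℝ) < b := by exact_mod_cast hb
  have hr : (1 : ℝ) < (a : ℝ) / b := by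
    rw [one_lt_div hb']
    exact_mod_cast hlt
  obtain ⟨N, hN⟩ := pow_unbounded_of_one_lt (C : ℝ) hr
  have h1 : (C : ℝ) < ((a : ℝ) / b) ^ (max N M) :=
    hN.trans_le (pow_le_pow_right₀ hr.le (le_max_left _ _))
  have h2 : (a : ℝ) ^ (max N M) ≤ C * b ^ (max N M) := by exact_mod_cast h _ (le_max_right _ _)
  rw [div_pow, lt_div_iff₀ (by positivity)] at h1
  linarith

/-! ### Passage to the family of graphs -/

theorem mem_familyPushableValues_le {Δ m : ℕ} (hΔ : 29 ≤ Δ)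
    (hm : m ∈ familyPushableValues (connectedGraphsOfMaxDegree.{u} Δ)) :
    m ≤ (Δ - 3) * (Δ - 1) * 2 ^ (Δ - 1) + 1 := by
  classical
  obtain ⟨G, ⟨hconn, hdeg⟩, rfl⟩ := hm
  obtain ⟨D, hD, hk⟩ := G.graph.isGreatest_pushableChromaticNumber.1
  rw [← hk]
  refine D.pushableChromaticNumber_le (k := Δ - 1) (by omega) (fun v => ?_)
    ((show D.underlying = G.graph from hD) ▸ hconn)
  have h1 : D.underlying = G.graph := hD
  have h2 := G.graph.degree_le_maxDegree v
  rw [← SimpleGraph.card_neighborFinset_eq_degree] at h2 ⊢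
  have : D.underlying.neighborFinset v = G.graph.neighborFinset v := by
    ext x; simp [h1]
  rw [this]
  have h3 : G.graph.maxDegree = Δ := by convert hdeg
  omega

theorem bipartiteCirculant_mem {Δ N : ℕ} [NeZero N] (hΔ : 2 ≤ Δ) (h : Δ ≤ N) :
    (⟨ULift.{u} (ZMod N × Bool), bipartiteCirculant Δ N⟩ : FiniteGraph.{u}) ∈
      connectedGraphsOfMaxDegree Δ := by
  classical
  refine ⟨bipartiteCirculant_connected hΔ, le_antisymm ?_ ?_⟩
  · exact SimpleGraph.maxDegree_le_of_forall_degree_le _ _ fun v =>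
      (bipartiteCirculant_degree h v).le
  · exact (bipartiteCirculant_degree h ⟨(0, false)⟩).ge.trans
      (SimpleGraph.degree_le_maxDegree _ _)

theorem theorem2 (Δ : ℕ) (hΔ : 29 ≤ Δ) :
    IsGreatest (familyPushableValues (connectedGraphsOfMaxDegree.{u} Δ))
      (familyPushableChromaticNumber (connectedGraphsOfMaxDegree.{u} Δ)) ∧
    (2 : ℝ) ^ ((Δ : ℝ) / 2 - 1) ≤
      (familyPushableChromaticNumber (connectedGraphsOfMaxDegree.{u} Δ) : ℝ) ∧
    (familyPushableChromaticNumber (connectedGraphsOfMaxDegree.{u} Δ) : ℝ) ≤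
      ((Δ : ℝ) - 3) * ((Δ : ℝ) - 1) * (2 : ℝ) ^ (Δ - 1) + 2 := by
  have hne : (familyPushableValues (connectedGraphsOfMaxDegree.{u} Δ)).Nonempty := by
    have : NeZero Δ := ⟨by omega⟩
    exact ⟨_, _, bipartiteCirculant_mem (by omega) le_rfl, rfl⟩
  have hbdd : BddAbove (familyPushableValues (connectedGraphsOfMaxDegree.{u} Δ)) :=
    ⟨_, fun m hm => mem_familyPushableValues_le hΔ hm⟩
  have hmax : IsGreatest (familyPushableValues (connectedGraphsOfMaxDegree.{u} Δ))
      (familyPushableChromaticNumber (connectedGraphsOfMaxDegree.{u} Δ)) :=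
    ⟨Nat.sSup_mem hne hbdd, fun _ h => le_csSup hbdd h⟩
  refine ⟨hmax, ?_, ?_⟩
  · set K := familyPushableChromaticNumber (connectedGraphsOfMaxDegree.{u} Δ) with hK
    -- `K` bounds the whole family, so it serves the circulants for all `N ≥ Δ` at once and the
    -- factor `2 ^ (K * K)` is constant in `N`.
    have hle : 2 ^ Δ ≤ 4 * K ^ 2 := by
      refine le_of_forall_pow_le_mul_pow (C := 2 ^ (K * K)) (M := Δ) fun N hN => ?_
      have : NeZero N := ⟨by omega⟩
      refine two_pow_le_of_forall_mem_pushableOrders.{u} hN fun f => ?_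
      set D := circulantOrientation.{u} hN f
      have h1 : D.pushableChromaticNumber ≤ (bipartiteCirculant.{u} Δ N).pushableChromaticNumber :=
        (SimpleGraph.isGreatest_pushableChromaticNumber _).2
          ⟨D, circulantOrientation_isOrientation hN f, rfl⟩
      have h2 : (bipartiteCirculant.{u} Δ N).pushableChromaticNumber ≤ K :=
        hmax.2 ⟨_, bipartiteCirculant_mem (by omega) hN, rfl⟩
      obtain ⟨H, φ, hφ⟩ := D.isLeast_pushableChromaticNumber.1
      exact hφ.mem_pushableOrders (by simpa using h1.trans h2)
    have hleR : (2 : ℝ) ^ Δ ≤ (2 * K) ^ 2 := by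
      rw [mul_pow]
      norm_num
      exact_mod_cast hle
    have hsq : ((2 : ℝ) ^ ((Δ : ℝ) / 2)) ^ 2 = 2 ^ Δ := by
      rw [← Real.rpow_natCast, ← Real.rpow_mul (by norm_num), ← Real.rpow_natCast]
      congr 1
      push_cast; ring
    rw [← hsq] at hleR
    have := le_of_pow_le_pow_left₀ two_ne_zero (by positivity) hleR
    rw [Real.rpow_sub (by norm_num), Real.rpow_one]
    linarith
  · have h := mem_familyPushableValues_le hΔ hmax.1
    have hR : (familyPushableChromaticNumber (connectedGraphsOfMaxDegree.{u} Δ) : ℝ) ≤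
        (((Δ - 3) * (Δ - 1) * 2 ^ (Δ - 1) + 1 : ℕ) : ℝ) := by exact_mod_cast h
    push_cast [Nat.cast_sub (show 3 ≤ Δ by omega), Nat.cast_sub (show 1 ≤ Δ by omega)] at hR
    linarith
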